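/- Let $K$ be a field of characteristic zero and let $S=K[t_1,\ldots,t_s]$. For $a\in\mathbb{N}^s$ write $t^a=t_1^{a_1}\cdots t_s^{a_s}$; a binomial is a polynomial of the form $t^a-t^b$ with $a,b\in\mathbb{N}^s$. A lattice ideal of $S$ is an ideal of the form $I(\mathcal{L})=(\{t^{c^+}-t^{c^-} : c\in\mathcal{L}\})$, where $\mathcal{L}$ is a subgroup of $\mathbb{Z}^s$ and $c^+$, $c^-$ denote the positive and negative parts of $c$, so that $c=c^+-c^-$. Let $L\subset S$ be an arbitrary lattice ideal of height $r$. If $\operatorname{rad}(L)=\operatorname{rad}(g_1,\ldots,g_r)$ for some binomials $g_1,\ldots,g_r$ of $S$, then $L=(g_1,\ldots,g_r)$. In particular, if $L$ is a binomial set theoretic complete intersection (that is, there are binomials $g_1,\ldots,g_r$ with $\operatorname{rad}(L)=\operatorname{rad}(g_1,\ldots,g_r)$, where $r$ is the height of $L$), then $L$ is a complete intersection (that is, $L$ is generated by $r$ elements of $S$, where $r$ is the height of $L$). -/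

import Mathlib

open MvPolynomial

namespace LatticeIdeals

noncomputable section

/-- The exponent vector of `ℕ ^ s` given by the positive part `c⁺` of `c ∈ ℤ ^ s`.
The negative part `c⁻` is `expPosPart (-c)`. -/
def expPosPart {s : ℕ} (c : Fin s → ℤ) : Fin s →₀ ℕ :=
  Finsupp.equivFunOnFinite.symm fun i => (c i).toNat

/-- The binomial `t ^ a - t ^ b` in the polynomial ring `K[t₁, …, tₛ]`. -/
def pureBinomial (K : Type*) [Field K] {s : ℕ} (a b : Fin s →₀ ℕ) : MvPolynomial (Fin s) K :=
  monomial a 1 - monomial b 1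

/-- A binomial is a polynomial of the form `t ^ a - t ^ b`. -/
def IsBinomial {K : Type*} [Field K] {s : ℕ} (f : MvPolynomial (Fin s) K) : Prop :=
  ∃ a b : Fin s →₀ ℕ, f = pureBinomial K a b

/-- The lattice ideal of a subgroup `𝓛` of `ℤ ^ s`, generated by the binomials
`t ^ (c⁺) - t ^ (c⁻)` with `c ∈ 𝓛`. -/
def latticeIdeal (K : Type*) [Field K] {s : ℕ} (𝓛 : AddSubgroup (Fin s → ℤ)) :
    Ideal (MvPolynomial (Fin s) K) :=
  Ideal.span {f | ∃ c ∈ 𝓛, f = pureBinomial K (expPosPart c) (expPosPart (-c))}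

/-- An ideal is a lattice ideal if it is the lattice ideal of some subgroup of `ℤ ^ s`. -/
def IsLatticeIdeal {K : Type*} [Field K] {s : ℕ} (L : Ideal (MvPolynomial (Fin s) K)) : Prop :=
  ∃ 𝓛 : AddSubgroup (Fin s → ℤ), L = latticeIdeal K 𝓛

/-- An ideal `I` is a binomial set theoretic complete intersection if, up to radical, it is
generated by `r` binomials, where `r` is the height of `I`. -/
def IsBinomialSetTheoreticCompleteIntersection {K : Type*} [Field K] {s : ℕ}
    (I : Ideal (MvPolynomial (Fin s) K)) : Prop :=
  ∃ (r : ℕ) (g : Fin r → MvPolynomial (Fin s) K), I.height = r ∧ (∀ i, IsBinomial (g i)) ∧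
    I.radical = (Ideal.span (Set.range g)).radical

/-- An ideal `I` is a complete intersection if it is generated by `r` elements,
where `r` is the height of `I`. -/
def IsCompleteIntersection {K : Type*} [Field K] {s : ℕ}
    (I : Ideal (MvPolynomial (Fin s) K)) : Prop :=
  ∃ (r : ℕ) (g : Fin r → MvPolynomial (Fin s) K), I.height = r ∧ I = Ideal.span (Set.range g)

end

end LatticeIdeals

/-!
Write `L` for the lattice ideal of `𝓛 ⊆ ℤ ^ s` and `J` for the ideal `(g₁, …, gᵣ)`.

The lattice ideal of `𝓛` is the kernel of the map from `K[t₁, …, tₛ]` to the group algebra of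
`ℤ ^ s / 𝓛` (`LatticeIdeals.latticeIdeal_eq_ker`). Two facts follow. Monomials are nonzerodivisors
modulo a lattice ideal, as they become units in the group algebra. And lattice ideals are radical
in characteristic zero, because there the group algebra of a finitely generated abelian group is
reduced: such a group is residually finite, and finite groups are covered by Maschke's theorem
(`AddMonoidAlgebra.isReduced_of_residuallyFinite`).

It remains to see that `J` is itself a lattice ideal: then both `J` and `L` are radical, and they
have the same radical. A binomial ideal is a lattice ideal as soon as monomials are nonzerodivisors
modulo it (`LatticeIdeals.eq_latticeIdeal_binomialLattice`). The zero divisors modulo `J` are the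
elements of its associated primes. Since `J` has height `r` and is generated by `r` elements of a
regular ring, it is unmixed (`mem_minimalPrimes_of_mem_associatedPrimes`): its associated primes are
minimal, so they are the minimal primes of `L`, and these contain no monomial.

Unmixedness is proved after localizing at an associated prime. A regular local ring of dimension `d`
has a regular sequence of length `d`; Rees' theorem lets depth pass to quotients by regular
elements, and the depth of a module is at most `dim R / p` for each associated prime `p`
(`length_le_ringKrullDim_quotient`, `exists_isRegular_of_supportDim_le`).
-/

/-! ### Regular sequences and associated primes in local rings -/

open IsLocalRing RingTheory.Sequence Pointwise in
/-- If `p` is associated to `M`, then some prime containing `p` and the `M`-regular element `x` is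
associated to `M / xM`: the elements of `M` killed by `p` do not all lie in `xM`, by Nakayama's
lemma. -/
theorem exists_mem_associatedPrimes_quotSMulTop {R : Type*} [CommRing R] [IsLocalRing R]
    [IsNoetherianRing R] {M : Type*} [AddCommGroup M] [Module R M] [Module.Finite R M] {x : R}
    (hx : x ∈ maximalIdeal R) (hreg : IsSMulRegular M x) {p : Ideal R}
    (hp : p ∈ associatedPrimes R M) :
    ∃ q ∈ associatedPrimes R (QuotSMulTop x M), p ≤ q ∧ x ∈ q := by
  have := isNoetherian_of_isNoetherianRing_of_finite R M
  obtain ⟨hpp, y, hy⟩ := isAssociatedPrime_iff.1 hp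
  let N : Submodule R M := Submodule.torsionBySet R M p
  have hyN : y ∈ N := by
    rw [Submodule.mem_torsionBySet_iff]
    rintro ⟨a, ha⟩
    rw [SetLike.mem_coe, hy, Submodule.mem_colon_singleton] at ha
    simpa using ha
  have hy0 : y ≠ 0 := by
    rintro rfl
    exact hpp.ne_top (by rw [hy]; simp)
  obtain ⟨u, huN, hu⟩ : ∃ u ∈ N, u ∉ x • (⊤ : Submodule R M) := by
    by_contra! h
    have hN : N ≤ maximalIdeal R • N := by
      intro u hu
      obtain ⟨v, -, rfl⟩ := (Submodule.mem_smul_pointwise_iff_exists u x ⊤).1 (h u hu)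
      refine Submodule.smul_mem_smul hx ?_
      rw [Submodule.mem_torsionBySet_iff] at hu ⊢
      intro a
      exact hreg.right_eq_zero_of_smul ((smul_comm x (a : R) v).trans (hu a))
    have hbot := Submodule.eq_bot_of_le_smul_of_le_jacobson_bot _ N (IsNoetherian.noetherian N) hN
      (maximalIdeal_le_jacobson _)
    exact hy0 (by simpa [hbot] using hyN)
  have hu0 : (Submodule.Quotient.mk u : QuotSMulTop x M) ≠ 0 := by
    rwa [Ne, Submodule.Quotient.mk_eq_zero]
  obtain ⟨q, hq, hle⟩ := exists_le_isAssociatedPrime_of_isNoetherianRing R _ hu0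
  refine ⟨q, hq, fun a ha => hle ?_, hle ?_⟩
  · rw [Submodule.mem_colon_singleton, ← Submodule.Quotient.mk_smul,
      (Submodule.mem_torsionBySet_iff _ _).1 huN ⟨a, ha⟩]
    simp
  · rw [Submodule.mem_colon_singleton, ← Submodule.Quotient.mk_smul, Submodule.mem_bot,
      Submodule.Quotient.mk_eq_zero]
    exact Submodule.smul_mem_pointwise_smul u x ⊤ trivial

open IsLocalRing RingTheory.Sequence in
/-- The dimension of `R / p`, for `p` an associated prime of `M`, bounds the length of every
`M`-regular sequence. -/
theorem length_le_ringKrullDim_quotient {R : Type*} [CommRing R] [IsLocalRing R]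
    [IsNoetherianRing R] {M : Type*} [AddCommGroup M] [Module R M] [Module.Finite R M]
    {rs : List R} (hmem : ∀ r ∈ rs, r ∈ maximalIdeal R) (hrs : IsRegular M rs) {p : Ideal R}
    (hp : p ∈ associatedPrimes R M) : (rs.length : WithBot ℕ∞) ≤ ringKrullDim (R ⧸ p) := by
  induction rs generalizing M p with
  | nil =>
    have := hp.1
    simpa using ringKrullDim_nonneg_of_nontrivial
  | cons x rs ih =>
    rw [isRegular_cons_iff] at hrs
    simp only [List.mem_cons, forall_eq_or_imp] at hmem
    obtain ⟨q, hq, hpq, hxq⟩ := exists_mem_associatedPrimes_quotSMulTop hmem.1 hrs.1 hp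
    have hxp : x ∉ p := by
      intro h
      have := Set.mem_biUnion (t := fun p : Ideal R => (p : Set R)) hp h
      rw [biUnion_associatedPrimes_eq_compl_regular] at this
      exact this hrs.1
    have := hp.1
    have hne : Ideal.Quotient.mk p x ≠ 0 := by rwa [Ne, Ideal.Quotient.eq_zero_iff_mem]
    have h1 := ringKrullDim_succ_le_of_surjective (Ideal.Quotient.factor hpq)
      (Ideal.Quotient.factor_surjective hpq) (mem_nonZeroDivisors_of_ne_zero hne)
      (by simpa [Ideal.Quotient.eq_zero_iff_mem] using hxq)
    refine le_trans ?_ h1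
    push_cast [List.length_cons]
    gcongr
    exact ih hmem.2 hrs.2 hq

universe u

open IsLocalRing RingTheory.Sequence in
/-- Killing a regular element lowers the depth by at most one; by Rees' theorem this follows from
the long exact sequence of `Ext`. -/
theorem exists_isRegular_quotSMulTop {R : Type u} [CommRing R] [IsLocalRing R]
    [IsNoetherianRing R] {M : Type u} [AddCommGroup M] [Module R M] [Module.Finite R M]
    {n : ℕ} (h : ∃ rs : List R, rs.length = n + 1 ∧ (∀ r ∈ rs, r ∈ maximalIdeal R) ∧
      IsRegular M rs)
    {x : R} (hx : x ∈ maximalIdeal R) (hreg : IsSMulRegular M x) :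
    ∃ rs : List R, rs.length = n ∧ (∀ r ∈ rs, r ∈ maximalIdeal R) ∧
      IsRegular (QuotSMulTop x M) rs := by
  obtain ⟨rs, hlen, hmem, hrs⟩ := h
  have : Nontrivial M := hrs.nontrivial
  have := nontrivial_quotSMulTop_of_mem_maximalIdeal M hx
  have hlt (N : Type u) [AddCommGroup N] [Module R N] [Module.Finite R N] [Nontrivial N] :
      maximalIdeal R • (⊤ : Submodule R (ModuleCat.of R N)) < ⊤ :=
    (Submodule.top_ne_ideal_smul_of_le_jacobson_annihilator
      (maximalIdeal_le_jacobson _)).symm.lt_top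
  have h1 := (ModuleCat.exists_isRegular_tfae (maximalIdeal R) (n + 1) (ModuleCat.of R M)
    (hlt M)).out 3 1
  have h2 := h1.1 ⟨rs, hlen, hmem, hrs⟩
  refine ((ModuleCat.exists_isRegular_tfae (maximalIdeal R) n
    (ModuleCat.of R (QuotSMulTop x M)) (hlt _)).out 1 3).1 fun i hi => ?_
  have zero1 := AddCommGrpCat.isZero_of_iff_subsingleton.mpr (h2 i (by omega))
  have zero2 := AddCommGrpCat.isZero_of_iff_subsingleton.mpr (h2 (i + 1) (by omega))
  exact AddCommGrpCat.subsingleton_of_isZero <|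
    CategoryTheory.ShortComplex.Exact.isZero_of_both_zeros
      ((CategoryTheory.Abelian.Ext.covariant_sequence_exact₃' _
        (IsSMulRegular.smulShortComplex_shortExact (M := ModuleCat.of R M) hreg)) i (i + 1) rfl)
      (zero1.eq_zero_of_src _) (zero2.eq_zero_of_tgt _)

open IsLocalRing RingTheory.Sequence Pointwise in
theorem supportDim_le_add_length {R : Type*} [CommRing R] [IsLocalRing R]
    [IsNoetherianRing R] {M : Type*} [AddCommGroup M] [Module R M] [Module.Finite R M]
    {gs : List R} (hgs : ∀ g ∈ gs, g ∈ maximalIdeal R) :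
    Module.supportDim R M ≤
      Module.supportDim R (M ⧸ Ideal.ofList gs • (⊤ : Submodule R M)) + gs.length := by
  induction gs generalizing M with
  | nil =>
    rw [Module.supportDim_eq_of_equiv
      (Submodule.quotEquivOfEqBot (Ideal.ofList [] • (⊤ : Submodule R M)) (by simp))]
    simp
  | cons x gs ih =>
    simp only [List.mem_cons, forall_eq_or_imp] at hgs
    rw [Module.supportDim_eq_of_equiv
      (Submodule.quotOfListConsSMulTopEquivQuotSMulTopInner M x gs)]
    refine (Module.supportDim_le_supportDim_quotSMulTop_succ hgs.1).trans ?_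
    push_cast [List.length_cons]
    rw [← add_assoc]
    gcongr
    exact ih hgs.2

theorem ringKrullDim_quotient_le_supportDim_quotSMulTop {R : Type*} [CommRing R]
    {M : Type*} [AddCommGroup M] [Module R M] [Module.Finite R M] {p : Ideal R}
    (hp : Module.annihilator R M ≤ p) {x : R} (hx : x ∈ p) :
    ringKrullDim (R ⧸ p) ≤ Module.supportDim R (QuotSMulTop x M) := by
  rw [ringKrullDim_quotient, Module.supportDim]
  have h : PrimeSpectrum.zeroLocus (p : Set R) ⊆ Module.support R (QuotSMulTop x M) := by
    rw [Module.support_quotSMulTop, Module.support_eq_zeroLocus]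
    exact Set.subset_inter (PrimeSpectrum.zeroLocus_anti_mono hp)
      (PrimeSpectrum.zeroLocus_anti_mono (by simpa using hx))
  exact Order.krullDim_le_of_strictMono (Set.inclusion h) fun _ _ hlt => hlt

open IsLocalRing RingTheory.Sequence Pointwise in
/-- If `M` has depth at least `n + k` and dividing by `k` elements leaves a module of dimension at
most `n`, then the quotient has depth at least `n`. (In other words, a part of a system of
parameters of a Cohen-Macaulay module is a regular sequence.) -/
theorem exists_isRegular_of_supportDim_le {R : Type u} [CommRing R] [IsLocalRing R]
    [IsNoetherianRing R] {M : Type u} [AddCommGroup M] [Module R M] [Module.Finite R M]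
    {gs : List R} {n : ℕ} (hgs : ∀ g ∈ gs, g ∈ maximalIdeal R)
    (hdepth : ∃ rs : List R, rs.length = n + gs.length ∧ (∀ r ∈ rs, r ∈ maximalIdeal R) ∧
      IsRegular M rs)
    (hdim : Module.supportDim R (M ⧸ Ideal.ofList gs • (⊤ : Submodule R M)) ≤ n) :
    ∃ rs : List R, rs.length = n ∧ (∀ r ∈ rs, r ∈ maximalIdeal R) ∧
      IsRegular (M ⧸ Ideal.ofList gs • (⊤ : Submodule R M)) rs := by
  induction gs generalizing M with
  | nil =>
    obtain ⟨rs, h1, h2, h3⟩ := hdepth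
    refine ⟨rs, by simpa using h1, h2, ?_⟩
    refine ((Submodule.quotEquivOfEqBot _ ?_).isRegular_congr rs).2 h3
    simp
  | cons x gs ih =>
    simp only [List.mem_cons, forall_eq_or_imp] at hgs
    let e := Submodule.quotOfListConsSMulTopEquivQuotSMulTopInner M x gs
    have hdim' := (Module.supportDim_eq_of_equiv e).symm.trans_le hdim
    have hx : Module.supportDim R (QuotSMulTop x M) ≤ n + gs.length := by
      refine (supportDim_le_add_length hgs.2).trans ?_
      gcongr
    have hreg : IsSMulRegular M x := by
      clear ih hdim hdim'
      -- A zero divisor `x` lies in an associated prime `p` of `M`; then `dim M / xM` is at least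
      -- `dim R / p`, hence at least the depth of `M`, which is too large.
      by_contra h
      have h : x ∈ ({ r : R | IsSMulRegular M r }ᶜ : Set R) := h
      rw [← biUnion_associatedPrimes_eq_compl_regular] at h
      obtain ⟨p, hp, hxp⟩ := Set.mem_iUnion₂.1 h
      obtain ⟨rs, h1, h2, h3⟩ := hdepth
      have h4 := length_le_ringKrullDim_quotient h2 h3 hp
      have hann : Module.annihilator R M ≤ p := by
        rw [← Submodule.annihilator_top]
        exact IsAssociatedPrime.annihilator_le hp
      have h5 : ringKrullDim (R ⧸ p) ≤ Module.supportDim R (QuotSMulTop x M) :=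
        ringKrullDim_quotient_le_supportDim_quotSMulTop hann hxp
      have h6 := h4.trans (h5.trans hx)
      rw [h1] at h6
      simp only [List.length_cons] at h6
      norm_cast at h6
      omega
    obtain ⟨rs, h1, h2, h3⟩ := ih hgs.2 (exists_isRegular_quotSMulTop hdepth hgs.1 hreg) hdim'
    exact ⟨rs, h1, h2, (e.isRegular_congr rs).2 h3⟩

/-! ### Regular local rings and unmixedness -/

open IsLocalRing in
/-- An element of `𝔪 ∖ 𝔪²` may replace one of the elements of a generating family of `𝔪`. -/
theorem exists_maximalIdeal_eq_span_insert {R : Type*} [CommRing R] [IsLocalRing R]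
    {d : ℕ} {y : Fin (d + 1) → R} (hy : maximalIdeal R = Ideal.span (Set.range y)) {x : R}
    (hx : x ∈ maximalIdeal R) (hx2 : x ∉ maximalIdeal R ^ 2) :
    ∃ z : Fin d → R, maximalIdeal R = Ideal.span (insert x (Set.range z)) := by
  have hym (i) : y i ∈ maximalIdeal R := hy ▸ Ideal.subset_span ⟨i, rfl⟩
  obtain ⟨c, hc⟩ : ∃ c : Fin (d + 1) → R, ∑ i, c i * y i = x := by
    rw [hy] at hx
    simpa [Ideal.mem_span_range_iff_exists_fun] using hx
  obtain ⟨i, hi⟩ : ∃ i, IsUnit (c i) := by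
    by_contra! h
    refine hx2 (hc ▸ Ideal.sum_mem _ fun i _ => ?_)
    rw [sq]
    exact Ideal.mul_mem_mul ((mem_maximalIdeal _).2 (h i)) (hym i)
  refine ⟨fun j => y (i.succAbove j), le_antisymm ?_ (Ideal.span_le.2 ?_)⟩
  · have hz (j) : y (i.succAbove j) ∈
        Ideal.span (insert x (Set.range fun j => y (i.succAbove j))) :=
      Ideal.subset_span (Or.inr ⟨j, rfl⟩)
    rw [hy, Ideal.span_le]
    rintro _ ⟨k, rfl⟩
    obtain rfl | ⟨j, rfl⟩ := Fin.eq_self_or_eq_succAbove i k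
    · rw [SetLike.mem_coe, ← Ideal.unit_mul_mem_iff_mem _ hi]
      rw [Fin.sum_univ_succAbove _ k] at hc
      rw [← eq_sub_iff_add_eq] at hc
      rw [hc]
      exact sub_mem (Ideal.subset_span (Or.inl rfl))
        (Ideal.sum_mem _ fun j _ => Ideal.mul_mem_left _ _ (hz j))
    · exact hz j
  · rintro _ (rfl | ⟨j, rfl⟩)
    · exact hx
    · exact hym _

open IsLocalRing RingTheory.Sequence Pointwise in
/-- A regular local ring of dimension `d` is a domain and has a regular sequence of length `d`.
Both are proved together by induction on `d`, dividing by an element of `𝔪` outside `𝔪²` and all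
minimal primes. -/
theorem exists_isRegular_of_maximalIdeal_eq_span (d : ℕ) {R : Type*} [CommRing R] [IsLocalRing R]
    [IsNoetherianRing R] (y : Fin d → R) (hy : maximalIdeal R = Ideal.span (Set.range y))
    (hd : (d : WithBot ℕ∞) ≤ ringKrullDim R) :
    IsDomain R ∧ ∃ rs : List R, rs.length = d ∧ IsRegular R rs := by
  induction d generalizing R with
  | zero =>
    have h0 : maximalIdeal R = ⊥ := by simp [hy]
    have : IsField R := isField_iff_maximalIdeal_eq.2 h0
    exact ⟨this.isDomain, [], rfl, IsRegular.nil R R⟩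
  | succ d ih =>
    have hfin := minimalPrimes.finite_of_isNoetherianRing R
    obtain ⟨x, hx, hx2, hxp⟩ : ∃ x ∈ maximalIdeal R, x ∉ maximalIdeal R ^ 2 ∧
        ∀ p ∈ minimalPrimes R, x ∉ p := by
      by_contra! h
      have hdim0 : ringKrullDim R ≠ 0 := by
        intro h0
        rw [h0] at hd
        norm_cast at hd
      have hsub : (maximalIdeal R : Set R) ⊆
          ⋃ I ∈ ((insert (maximalIdeal R ^ 2) hfin.toFinset : Finset (Ideal R)) : Set (Ideal R)),
            ((id I : Ideal R) : Set R) := by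
        intro x hx
        by_cases hx2 : x ∈ maximalIdeal R ^ 2
        · exact Set.mem_biUnion (by simp) hx2
        · obtain ⟨p, hp, hxp⟩ := h x hx hx2
          exact Set.mem_biUnion (x := p) (by simp [hp]) hxp
      rw [Ideal.subset_union_prime (maximalIdeal R ^ 2) (maximalIdeal R ^ 2)
        (fun I hI h1 _ => by
          simp only [Finset.mem_insert, h1, Set.Finite.mem_toFinset, false_or] at hI
          exact hI.isPrime)] at hsub
      obtain ⟨I, hI, hle⟩ := hsub
      rw [Finset.mem_insert, Set.Finite.mem_toFinset] at hI
      obtain rfl | hI := hI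
      · have hbot := Submodule.eq_bot_of_le_smul_of_le_jacobson_bot (maximalIdeal R)
          (maximalIdeal R) (IsNoetherian.noetherian _) (by simpa [sq] using hle)
          (maximalIdeal_le_jacobson _)
        exact hdim0 (ringKrullDim_eq_zero_of_isField (isField_iff_maximalIdeal_eq.2 hbot))
      · have := hI.isPrime
        have hIm : maximalIdeal R = I := (maximalIdeal.isMaximal R).eq_of_le hI.isPrime.ne_top hle
        rw [← maximalIdeal_height_eq_ringKrullDim, hIm, Ideal.height_eq_zero_iff.2 hI] at hdim0
        exact hdim0 rfl
    obtain ⟨z, hz⟩ := exists_maximalIdeal_eq_span_insert hy hx hx2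
    have hne : Ideal.span {x} ≠ ⊤ := fun h => (Ideal.ne_top_iff_one _).1
      (maximalIdeal.isMaximal R).ne_top
      ((Ideal.span_singleton_le_iff_mem _).2 hx (h ▸ Submodule.mem_top))
    have : Nontrivial (R ⧸ Ideal.span {x}) := Ideal.Quotient.nontrivial_iff.2 hne
    have : IsLocalRing (R ⧸ Ideal.span {x}) :=
      .of_surjective' _ Ideal.Quotient.mk_surjective
    have hx0 : Ideal.Quotient.mk (Ideal.span {x}) x = 0 :=
      Ideal.Quotient.eq_zero_iff_mem.2 (Ideal.mem_span_singleton_self x)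
    have hmax : maximalIdeal (R ⧸ Ideal.span {x}) =
        Ideal.span (Set.range fun i => Ideal.Quotient.mk (Ideal.span {x}) (z i)) := by
      rw [← map_maximalIdeal_of_surjective _ Ideal.Quotient.mk_surjective, hz, Ideal.map_span,
        Set.image_insert_eq, hx0, Ideal.span_insert_zero, ← Set.range_comp]
      rfl
    have hdim : (d : WithBot ℕ∞) ≤ ringKrullDim (R ⧸ Ideal.span {x}) := by
      have h := hd.trans (ringKrullDim_le_ringKrullDim_quotSMulTop_succ hx)
      rw [← Submodule.ideal_span_singleton_smul] at h
      rw [smul_eq_mul, Ideal.mul_top] at h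
      push_cast at h
      exact ENat.WithBot.add_le_add_one_right_iff.1 h
    obtain ⟨hdom, rs, hrs, hreg⟩ := ih _ hmax hdim
    have hprime : (Ideal.span {x}).IsPrime := (Ideal.Quotient.isDomain_iff_prime _).1 hdom
    -- A minimal prime `p` inside the prime ideal `(x)` satisfies `p = x p`, so it vanishes.
    have hR : IsDomain R := by
      obtain ⟨p, hp, hpx⟩ := Ideal.exists_minimalPrimes_le (I := ⊥) (J := Ideal.span {x}) bot_le
      have := hp.isPrime
      have hle : p ≤ maximalIdeal R • p := by
        intro a ha
        obtain ⟨b, rfl⟩ := Ideal.mem_span_singleton.1 (hpx ha)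
        exact Ideal.mul_mem_mul hx ((this.mem_or_mem ha).resolve_left (hxp p hp))
      have hbot := Submodule.eq_bot_of_le_smul_of_le_jacobson_bot (maximalIdeal R) p
        (IsNoetherian.noetherian _) hle (maximalIdeal_le_jacobson _)
      exact IsDomain.of_bot_isPrime R (hbp := hbot ▸ this)
    refine ⟨hR, ?_⟩
    choose f hf using Ideal.Quotient.mk_surjective (I := Ideal.span {x})
    refine ⟨x :: rs.map f, by simp [hrs], ?_⟩
    rw [isRegular_cons_iff']
    constructor
    · rw [isSMulRegular_iff_right_eq_zero_of_smul]
      intro a ha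
      refine (mul_eq_zero.1 ha).resolve_left ?_
      rintro rfl
      exact hx2 (zero_mem _)
    · have h1 : (rs.map f).map (Ideal.Quotient.mk (Ideal.span {x})) = rs := by
        rw [List.map_map]
        exact (List.map_congr_left fun a _ => hf a).trans (List.map_id _)
      rw [h1]
      let e : QuotSMulTop x R ≃ₗ[R] R ⧸ Ideal.span {x} :=
        Submodule.quotEquivOfEq _ _ (by simp [← Submodule.ideal_span_singleton_smul])
      refine (AddEquiv.isRegular_congr (e := e.toAddEquiv) (List.forall₂_same.mpr ?_)).2 hreg
      intro a _ b
      obtain ⟨a, rfl⟩ := Ideal.Quotient.mk_surjective a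
      exact e.map_smul a b

open RingTheory.Sequence IsLocalRing in
theorem IsRegularLocalRing.exists_isRegular (R : Type*) [CommRing R] [IsRegularLocalRing R] :
    ∃ rs : List R, (rs.length : WithBot ℕ∞) = ringKrullDim R ∧
      (∀ r ∈ rs, r ∈ maximalIdeal R) ∧ IsRegular R rs := by
  have hfg := (maximalIdeal R).fg_of_isNoetherianRing
  have hdim := (isRegularLocalRing_iff R).1 ‹_›
  have hcard := Submodule.FG.generators_ncard hfg
  have hfin := Submodule.FG.finite_generators hfg
  have := hfin.to_subtype
  let e : Fin (maximalIdeal R).spanFinrank ≃ (maximalIdeal R).generators :=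
    (Finite.equivFinOfCardEq (by rwa [Nat.card_coe_set_eq])).symm
  obtain ⟨-, rs, hlen, hrs⟩ := exists_isRegular_of_maximalIdeal_eq_span
    (maximalIdeal R).spanFinrank (fun i => (e i : R)) (by
      rw [show (fun i => (e i : R)) = Subtype.val ∘ e from rfl, e.surjective.range_comp,
        Subtype.range_coe]
      exact (Submodule.span_generators _).symm) hdim.le
  refine ⟨rs, by rw [hlen, hdim], fun r hr => ?_, hrs⟩
  rw [mem_maximalIdeal]
  intro hu
  refine hrs.2 ?_
  rw [Ideal.eq_top_of_isUnit_mem (Ideal.ofList rs) (Ideal.subset_span hr) hu, smul_eq_mul,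
    Ideal.mul_top]

theorem Ideal.add_ringKrullDim_quotient_le {R : Type*} [CommRing R] {I : Ideal R} {r : ℕ}
    (hr : (r : ℕ∞) ≤ I.height) : r + ringKrullDim (R ⧸ I) ≤ ringKrullDim R := by
  rw [ringKrullDim_quotient]
  obtain hI | hI := isEmpty_or_nonempty (PrimeSpectrum.zeroLocus (I : Set R))
  · rw [Order.krullDim_eq_bot, WithBot.add_bot]
    exact bot_le
  have : Nonempty (PrimeSpectrum R) := hI.map Subtype.val
  -- Along a chain of primes containing `I`, the height starts at `r` or more and increases.
  have hlen (l : LTSeries (PrimeSpectrum.zeroLocus (I : Set R))) (i : ℕ) (hi : i < l.length + 1) :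
      ((r + i : ℕ) : ℕ∞) ≤ (l ⟨i, hi⟩).1.asIdeal.height := by
    induction i with
    | zero => exact hr.trans (Ideal.height_mono (l ⟨0, hi⟩).2)
    | succ i ih =>
      have h1 := ih (by omega)
      have h2 : (l ⟨i, by omega⟩).1.asIdeal < (l ⟨i + 1, hi⟩).1.asIdeal :=
        l.step ⟨i, by omega⟩
      refine le_trans ?_ (Ideal.height_add_one_le_of_lt_of_isPrime h2)
      rw [← add_assoc, Nat.cast_add]
      exact add_le_add_left h1 _
  rw [Order.krullDim_eq_iSup_length, ringKrullDim, Order.krullDim_eq_iSup_length]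
  have : ((r : ℕ∞) : WithBot ℕ∞) = (r : WithBot ℕ∞) := rfl
  rw [← this, ← WithBot.coe_add, ENat.add_iSup, WithBot.coe_le_coe, iSup_le_iff]
  intro l
  rw [← WithBot.coe_le_coe, ← Order.krullDim_eq_iSup_length]
  refine le_trans ?_ (Ideal.height_le_ringKrullDim_of_isPrime (I := l.last.1.asIdeal))
  rw [WithBot.coe_le_coe]
  exact_mod_cast hlen l l.length (Nat.lt_succ_self _)

open RingTheory.Sequence IsLocalRing in
/-- The unmixedness theorem in regular rings: an ideal generated by `r` elements and of height at
least `r` has no embedded primes. -/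
theorem mem_minimalPrimes_of_mem_associatedPrimes {S : Type u} [CommRing S] [IsRegularRing S]
    {r : ℕ} (g : Fin r → S) (hr : (r : ℕ∞) ≤ (Ideal.span (Set.range g)).height) {q : Ideal S}
    (hq : q ∈ associatedPrimes S (S ⧸ Ideal.span (Set.range g))) :
    q ∈ (Ideal.span (Set.range g)).minimalPrimes := by
  have hqp := hq.1
  have hJq : Ideal.span (Set.range g) ≤ q := by
    have := IsAssociatedPrime.annihilator_le hq
    rwa [Submodule.annihilator_top, Ideal.annihilator_quotient] at this
  refine Ideal.mem_minimalPrimes_of_height_le hJq (le_trans ?_ hr)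
  let R := Localization.AtPrime q
  have : IsRegularLocalRing R := IsRegularRing.isRegularLocalRing_localization q
  obtain ⟨rs, hlen, hmem, hrs⟩ := IsRegularLocalRing.exists_isRegular R
  let gs : List R := List.ofFn fun i => algebraMap S R (g i)
  have hgs : ∀ x ∈ gs, x ∈ maximalIdeal R := by
    intro x hx
    obtain ⟨i, rfl⟩ := List.mem_ofFn.1 hx
    exact (IsLocalization.AtPrime.to_map_mem_maximal_iff R q _).2
      (hJq (Ideal.subset_span ⟨i, rfl⟩))
  have hspan : Ideal.ofList gs = (Ideal.span (Set.range g)).map (algebraMap S R) := by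
    rw [Ideal.map_span, Ideal.ofList, ← Set.range_comp]
    congr 1
    ext x
    simp [gs, List.mem_ofFn]
  have hheight : (r : ℕ∞) ≤ (Ideal.ofList gs).height := by
    rw [hspan, ← IsLocalization.height_under q.primeCompl]
    exact hr.trans (Ideal.height_mono Ideal.le_comap_map)
  have hdim := Ideal.add_ringKrullDim_quotient_le hheight
  rw [← hlen] at hdim
  have hass : maximalIdeal R ∈ associatedPrimes R
      (R ⧸ Ideal.ofList gs • (⊤ : Submodule R R)) := by
    have hloc : Submodule.localized' R q.primeCompl (Algebra.linearMap S R)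
        (Ideal.span (Set.range g)) = Ideal.ofList gs • (⊤ : Submodule R R) := by
      rw [hspan, smul_eq_mul, Ideal.mul_top]
      exact Ideal.localized'_eq_map _ _ _
    rw [← hloc]
    refine Module.associatedPrimes.mem_associatedPrimes_of_comap_mem_associatedPrimes_of_isLocalizedModule
      q.primeCompl (Submodule.toLocalizedQuotient' R q.primeCompl (Algebra.linearMap S R)
        (Ideal.span (Set.range g))) _ ?_
    rw [← Ideal.under_def, IsLocalization.AtPrime.under_maximalIdeal R q]
    exact hq
  have hJtop : Ideal.ofList gs ≠ ⊤ := fun h => (maximalIdeal.isMaximal R).ne_top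
    (top_le_iff.1 (h ▸ Ideal.span_le.2 hgs))
  have : Nontrivial (R ⧸ Ideal.ofList gs) := Ideal.Quotient.nontrivial_iff.2 hJtop
  have hle : r ≤ rs.length := by
    have h := le_trans (add_le_add_right (ringKrullDim_nonneg_of_nontrivial
      (R := R ⧸ Ideal.ofList gs)) (r : WithBot ℕ∞)) hdim
    rw [add_zero] at h
    exact_mod_cast h
  -- `R / (g)` has depth at least `n = dim R - r`, while its associated prime `𝔪` has
  -- `dim R / 𝔪 = 0`. Hence `n = 0`, that is, `q` has height `r`.
  obtain ⟨n, hn⟩ := Nat.exists_eq_add_of_le hle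
  have hdim' : Module.supportDim R (R ⧸ Ideal.ofList gs • (⊤ : Submodule R R)) ≤ n := by
    rw [smul_eq_mul, Ideal.mul_top, Module.supportDim_quotient_eq_ringKrullDim]
    rw [hn, Nat.cast_add] at hdim
    exact ENat.WithBot.add_le_add_natCast_left_iff.1 hdim
  obtain ⟨rs', hlen', hmem', hrs'⟩ := exists_isRegular_of_supportDim_le hgs
    ⟨rs, by simp [gs, hn, add_comm], hmem, hrs⟩ hdim'
  have hn0 := length_le_ringKrullDim_quotient hmem' hrs' hass
  rw [hlen', ringKrullDim_eq_zero_of_isField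
    ((Ideal.Quotient.maximal_ideal_iff_isField_quotient _).1 (maximalIdeal.isMaximal R))] at hn0
  have hn0 : n = 0 := Nat.le_zero.1 (by exact_mod_cast hn0)
  have hht := (IsLocalization.AtPrime.ringKrullDim_eq_height q R).symm.trans hlen.symm
  rw [hn, hn0, add_zero] at hht
  exact (WithBot.coe_inj.1 hht).le

/-! ### Group algebras of finitely generated abelian groups -/

theorem AddGroup.ResiduallyFinite.of_fg_addCommGroup (A : Type*) [AddCommGroup A]
    [AddGroup.FG A] : AddGroup.ResiduallyFinite A := by
  obtain ⟨n, ι, _, p, hp, e, ⟨f⟩⟩ := AddCommGroup.equiv_free_prod_directSum_zmod A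
  have key {m : ℕ} [NeZero m] (ψ : A →+ ZMod m) {a : A} (ha : ψ a ≠ 0) :
      ∃ H : AddSubgroup A, H.FiniteIndex ∧ a ∉ H :=
    ⟨ψ.ker, inferInstance, ha⟩
  rw [AddGroup.residuallyFinite_iff_exists_finiteIndex]
  intro a ha
  have hfa : f a ≠ 0 := by simpa using ha
  by_cases h1 : (f a).1 = 0
  · have h2 : (f a).2 ≠ 0 := fun h2 => hfa (Prod.ext h1 h2)
    obtain ⟨i, hi⟩ := DFunLike.ne_iff.1 h2
    have : NeZero (p i ^ e i) := ⟨pow_ne_zero _ (hp i).ne_zero⟩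
    exact key ((DFinsupp.evalAddMonoidHom i).comp ((AddMonoidHom.snd _ _).comp f.toAddMonoidHom)) hi
  · obtain ⟨i, hi⟩ := DFunLike.ne_iff.1 h1
    -- A nonzero integer `z` stays nonzero modulo `|z| + 1`.
    refine key (m := ((f a).1 i).natAbs + 1) ((Int.castAddHom _).comp
      ((Finsupp.applyAddHom i).comp ((AddMonoidHom.fst _ _).comp f.toAddMonoidHom))) fun h => hi ?_
    have h' : (((f a).1 i : ℤ) : ZMod (((f a).1 i).natAbs + 1)) = 0 := h
    rw [ZMod.intCast_zmod_eq_zero_iff_dvd] at h'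
    exact Int.eq_zero_of_abs_lt_dvd h' (by rw [Int.abs_eq_natAbs]; push_cast; omega)

/-- In characteristic zero the group algebra of a residually finite abelian group is reduced: by
Maschke's theorem this holds for finite groups, and any nonzero element of the group algebra
survives in the group algebra of a suitable finite quotient. -/
theorem AddMonoidAlgebra.isReduced_of_residuallyFinite (K A : Type*) [Field K] [CharZero K]
    [AddCommGroup A] [AddGroup.ResiduallyFinite A] : IsReduced (AddMonoidAlgebra K A) := by
  classical
  refine ⟨fun f hf => ?_⟩
  by_contra hf0
  obtain ⟨a, ha⟩ : ∃ a, f.coeff a ≠ 0 := by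
    by_contra! h
    exact hf0 (by ext a; exact h a)
  -- Separating `a` from the rest of the support is enough to keep the coefficient of `a` unchanged
  -- in the quotient.
  have hsep (b : A) : ∃ H : AddSubgroup A, H.FiniteIndex ∧ (b ≠ a → b - a ∉ H) := by
    by_cases hb : b = a
    · exact ⟨⊤, inferInstance, fun h => absurd hb h⟩
    · obtain ⟨H, h1, h2⟩ := AddGroup.residuallyFinite_iff_exists_finiteIndex.1 ‹_› (b - a)
        (sub_ne_zero.2 hb)
      exact ⟨H, h1, fun _ => h2⟩
  choose H hfin hH using hsep
  let N : AddSubgroup A := ⨅ b : f.coeff.support, H b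
  have hN : N.FiniteIndex := AddSubgroup.finiteIndex_iInf fun b => hfin b
  have : Finite (A ⧸ N) := inferInstance
  have : NeZero (Nat.card (A ⧸ N) : K) := ⟨by exact_mod_cast Nat.card_pos.ne'⟩
  have hred : IsReduced (AddMonoidAlgebra K (A ⧸ N)) := inferInstance
  have h0 : AddMonoidAlgebra.mapDomainAlgHom K K (QuotientAddGroup.mk' N) f = 0 :=
    (hf.map _).eq_zero
  have h1 : (AddMonoidAlgebra.mapDomain (QuotientAddGroup.mk' N) f).coeff
      (QuotientAddGroup.mk' N a) = 0 := by
    have h2 : AddMonoidAlgebra.mapDomain (QuotientAddGroup.mk' N) f = 0 := h0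
    rw [h2]
    rfl
  rw [AddMonoidAlgebra.coeff_mapDomain, Finsupp.mapDomain, Finsupp.sum_apply, Finsupp.sum,
    Finset.sum_eq_single a] at h1
  · exact ha (by simpa using h1)
  · intro b hb hba
    refine Finsupp.single_eq_of_ne fun h => hH b hba ?_
    have h3 : b - a ∈ N := by
      rw [← QuotientAddGroup.eq_iff_sub_mem]
      exact h.symm
    exact (AddSubgroup.mem_iInf.1 h3) ⟨b, hb⟩
  · intro h
    simp [Finsupp.notMem_support_iff.1 h]

/-! ### Lattice ideals as kernels -/

namespace LatticeIdeals

noncomputable section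

variable {s : ℕ}

/-- The class of an exponent vector `a ∈ ℕ ^ s` in the quotient group `ℤ ^ s / 𝓛`. -/
def expClass (𝓛 : AddSubgroup (Fin s → ℤ)) : (Fin s →₀ ℕ) →+ (Fin s → ℤ) ⧸ 𝓛 where
  toFun a := QuotientAddGroup.mk' 𝓛 fun i => (a i : ℤ)
  map_zero' := by
    rw [← map_zero (QuotientAddGroup.mk' 𝓛)]
    congr 1
  map_add' a b := by
    rw [← map_add]
    exact congrArg _ (funext fun i => Nat.cast_add (a i) (b i))

theorem expClass_eq_iff {𝓛 : AddSubgroup (Fin s → ℤ)} {a b : Fin s →₀ ℕ} :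
    expClass 𝓛 a = expClass 𝓛 b ↔ (fun i => (a i : ℤ) - b i) ∈ 𝓛 :=
  QuotientAddGroup.eq_iff_sub_mem

variable (K : Type*) [Field K]

/-- The algebra map from `K[t₁, …, tₛ]` to the group algebra of `ℤ ^ s / 𝓛` that sends `t ^ a` to the
class of `a`. -/
def latticeHom (𝓛 : AddSubgroup (Fin s → ℤ)) :
    MvPolynomial (Fin s) K →ₐ[K] AddMonoidAlgebra K ((Fin s → ℤ) ⧸ 𝓛) :=
  AddMonoidAlgebra.mapDomainAlgHom K K (expClass 𝓛)

variable {K}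

theorem latticeHom_monomial (𝓛 : AddSubgroup (Fin s → ℤ)) (a : Fin s →₀ ℕ) (c : K) :
    latticeHom K 𝓛 (monomial a c) = AddMonoidAlgebra.single (expClass 𝓛 a) c :=
  AddMonoidAlgebra.mapDomain_single

theorem pureBinomial_mem_ker_latticeHom_iff {𝓛 : AddSubgroup (Fin s → ℤ)} {a b : Fin s →₀ ℕ} :
    pureBinomial K a b ∈ RingHom.ker (latticeHom K 𝓛) ↔ (fun i => (a i : ℤ) - b i) ∈ 𝓛 := by
  rw [RingHom.mem_ker, pureBinomial, map_sub, latticeHom_monomial, latticeHom_monomial,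
    sub_eq_zero, ← expClass_eq_iff]
  refine ⟨fun h => ?_, fun h => by rw [h]⟩
  have h := congrArg AddMonoidAlgebra.coeff h
  rw [AddMonoidAlgebra.coeff_single, AddMonoidAlgebra.coeff_single] at h
  exact Finsupp.single_left_injective one_ne_zero h

/-- The kernel of `latticeHom K 𝓛` is generated by the binomials `t ^ a - t ^ b` with
`a - b ∈ 𝓛`: modulo these, every polynomial `f` agrees with the polynomial obtained from its image
by choosing one exponent vector in each class. -/
theorem ker_latticeHom_le {𝓛 : AddSubgroup (Fin s → ℤ)} {J : Ideal (MvPolynomial (Fin s) K)}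
    (h : ∀ a b : Fin s →₀ ℕ, (fun i => (a i : ℤ) - b i) ∈ 𝓛 → pureBinomial K a b ∈ J) :
    RingHom.ker (latticeHom K 𝓛) ≤ J := by
  let σ := Function.invFun (expClass 𝓛)
  let ψ : AddMonoidAlgebra K ((Fin s → ℤ) ⧸ 𝓛) →ₗ[K] MvPolynomial (Fin s) K :=
    (Finsupp.linearCombination K fun α => monomial (σ α) (1 : K)) ∘ₗ
      (AddMonoidAlgebra.coeffLinearEquiv K).toLinearMap
  have hψ (α) (c : K) : ψ (AddMonoidAlgebra.single α c) = monomial (σ α) c := by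
    simp [ψ, smul_monomial]
  have key (f : MvPolynomial (Fin s) K) : f - ψ (latticeHom K 𝓛 f) ∈ J := by
    induction f using MvPolynomial.induction_on' with
    | monomial a c =>
      have h1 : expClass 𝓛 (σ (expClass 𝓛 a)) = expClass 𝓛 a :=
        Function.invFun_eq ⟨a, rfl⟩
      have h2 : monomial a c - monomial (σ (expClass 𝓛 a)) c =
          C c * pureBinomial K a (σ (expClass 𝓛 a)) := by
        rw [pureBinomial, mul_sub, C_mul_monomial, C_mul_monomial, mul_one]
      rw [latticeHom_monomial, hψ, h2]
      exact J.mul_mem_left _ (h _ _ (expClass_eq_iff.1 h1.symm))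
    | add f g hf hg =>
      rw [map_add, map_add, add_sub_add_comm]
      exact J.add_mem hf hg
  intro f hf
  have h1 := key f
  rwa [(RingHom.mem_ker).1 hf, map_zero, sub_zero] at h1

theorem latticeIdeal_eq_ker (𝓛 : AddSubgroup (Fin s → ℤ)) :
    latticeIdeal K 𝓛 = RingHom.ker (latticeHom K 𝓛) := by
  refine le_antisymm (Ideal.span_le.2 ?_) (ker_latticeHom_le fun a b hab => ?_)
  · rintro _ ⟨c, hc, rfl⟩
    rw [SetLike.mem_coe, pureBinomial_mem_ker_latticeHom_iff]
    convert hc using 2 with i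
    simp only [expPosPart, Finsupp.equivFunOnFinite_symm_apply_apply, Pi.neg_apply]
    omega
  · have h1 : pureBinomial K a b = monomial (a ⊓ b) 1 *
        pureBinomial K (expPosPart fun i => (a i : ℤ) - b i)
          (expPosPart (-fun i => (a i : ℤ) - b i)) := by
      rw [pureBinomial, pureBinomial, mul_sub, monomial_mul, monomial_mul, one_mul]
      congr 2 <;>
      · congr 1
        ext i
        simp [expPosPart]
        omega
    rw [h1]
    exact Ideal.mul_mem_left _ _ (Ideal.subset_span ⟨_, hab, rfl⟩)

theorem isRadical_latticeIdeal [CharZero K] (𝓛 : AddSubgroup (Fin s → ℤ)) :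
    (latticeIdeal K 𝓛).IsRadical := by
  have := AddGroup.ResiduallyFinite.of_fg_addCommGroup ((Fin s → ℤ) ⧸ 𝓛)
  have := AddMonoidAlgebra.isReduced_of_residuallyFinite K ((Fin s → ℤ) ⧸ 𝓛)
  rw [latticeIdeal_eq_ker]
  rintro f ⟨n, hf⟩
  rw [RingHom.mem_ker, map_pow] at hf
  exact eq_zero_of_pow_eq_zero hf

/-- Monomials are nonzerodivisors modulo a lattice ideal, since they become units in the group
algebra. -/
theorem mem_latticeIdeal_of_monomial_mul_mem {𝓛 : AddSubgroup (Fin s → ℤ)} {u : Fin s →₀ ℕ}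
    {f : MvPolynomial (Fin s) K} (h : monomial u 1 * f ∈ latticeIdeal K 𝓛) :
    f ∈ latticeIdeal K 𝓛 := by
  rw [latticeIdeal_eq_ker, RingHom.mem_ker] at h ⊢
  rw [map_mul, latticeHom_monomial] at h
  have h1 := congrArg (AddMonoidAlgebra.single (-expClass 𝓛 u) (1 : K) * ·) h
  simpa [← mul_assoc, AddMonoidAlgebra.single_mul_single, ← AddMonoidAlgebra.one_def] using h1


/-! ### Binomial ideals modulo which monomials are nonzerodivisors -/

/-- The subgroup of `ℤ ^ s` of all differences `a - b` with `t ^ a - t ^ b ∈ J`. -/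
def binomialLattice (J : Ideal (MvPolynomial (Fin s) K)) : AddSubgroup (Fin s → ℤ) where
  carrier := {c | ∃ a b : Fin s →₀ ℕ, (c = fun i => (a i : ℤ) - b i) ∧ pureBinomial K a b ∈ J}
  zero_mem' := ⟨0, 0, by ext; simp, by simp [pureBinomial]⟩
  add_mem' := by
    rintro _ _ ⟨a, b, rfl, h⟩ ⟨a', b', rfl, h'⟩
    refine ⟨a + a', b + b', ?_, ?_⟩
    · ext i
      simp only [Pi.add_apply, Finsupp.add_apply]
      push_cast
      ring
    · have h1 : pureBinomial K (a + a') (b + b') =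
          monomial a' 1 * pureBinomial K a b + monomial b 1 * pureBinomial K a' b' := by
        simp only [pureBinomial, mul_sub, monomial_mul, one_mul, add_comm a']
        rw [sub_add_sub_cancel]
      rw [h1]
      exact J.add_mem (J.mul_mem_left _ h) (J.mul_mem_left _ h')
  neg_mem' := by
    rintro _ ⟨a, b, rfl, h⟩
    refine ⟨b, a, by ext i; simp, ?_⟩
    rw [pureBinomial, ← neg_sub]
    exact J.neg_mem h

/-- If `a - b = u - v` with `t ^ u - t ^ v ∈ J`, then `t ^ v * (t ^ a - t ^ b)` equals
`t ^ b * (t ^ u - t ^ v)`, and the factor `t ^ v` can be cancelled modulo `J`. -/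
theorem pureBinomial_mem_of_mem_binomialLattice {J : Ideal (MvPolynomial (Fin s) K)}
    (hJ : ∀ (u : Fin s →₀ ℕ) (f : MvPolynomial (Fin s) K), monomial u 1 * f ∈ J → f ∈ J)
    {a b : Fin s →₀ ℕ} (h : (fun i => (a i : ℤ) - b i) ∈ binomialLattice J) :
    pureBinomial K a b ∈ J := by
  obtain ⟨u, v, huv, hJuv⟩ := h
  refine hJ v _ ?_
  have h1 : monomial v 1 * pureBinomial K a b = monomial b 1 * pureBinomial K u v := by
    rw [pureBinomial, pureBinomial, mul_sub, mul_sub]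
    simp only [monomial_mul, one_mul]
    rw [add_comm b v]
    congr 2
    congr 1
    ext i
    have := congrFun huv i
    simp only [Finsupp.add_apply]
    omega
  rw [h1]
  exact J.mul_mem_left _ hJuv

/-- A binomial ideal modulo which all monomials are nonzerodivisors is a lattice ideal. -/
theorem eq_latticeIdeal_binomialLattice {r : ℕ} {g : Fin r → MvPolynomial (Fin s) K}
    (hg : ∀ i, IsBinomial (g i))
    (hsat : ∀ (u : Fin s →₀ ℕ) (f : MvPolynomial (Fin s) K),
      monomial u 1 * f ∈ Ideal.span (Set.range g) → f ∈ Ideal.span (Set.range g)) :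
    Ideal.span (Set.range g) = latticeIdeal K (binomialLattice (Ideal.span (Set.range g))) := by
  rw [latticeIdeal_eq_ker]
  refine le_antisymm (Ideal.span_le.2 ?_) (ker_latticeHom_le fun a b hab =>
    pureBinomial_mem_of_mem_binomialLattice hsat hab)
  rintro _ ⟨i, rfl⟩
  obtain ⟨a, b, hab⟩ := hg i
  rw [SetLike.mem_coe, hab, pureBinomial_mem_ker_latticeHom_iff]
  exact ⟨a, b, rfl, hab ▸ Ideal.subset_span ⟨i, rfl⟩⟩

/-- If `r` elements cut out, up to radical, a lattice ideal of height `r`, then monomials are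
nonzerodivisors modulo the ideal `J` they generate: the associated primes of `J` are its minimal
primes by unmixedness, these are the minimal primes of the lattice ideal, and no monomial lies in
any of them. -/
theorem mem_span_of_monomial_mul_mem {r : ℕ} {g : Fin r → MvPolynomial (Fin s) K}
    {𝓛 : AddSubgroup (Fin s → ℤ)}
    (hheight : (latticeIdeal K 𝓛).height = r)
    (hrad : (latticeIdeal K 𝓛).radical = (Ideal.span (Set.range g)).radical)
    (u : Fin s →₀ ℕ) (f : MvPolynomial (Fin s) K)
    (h : monomial u 1 * f ∈ Ideal.span (Set.range g)) : f ∈ Ideal.span (Set.range g) := by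
  have hmin : (Ideal.span (Set.range g)).minimalPrimes = (latticeIdeal K 𝓛).minimalPrimes := by
    rw [← Ideal.radical_minimalPrimes, ← hrad, Ideal.radical_minimalPrimes]
  have hJ : (r : ℕ∞) ≤ (Ideal.span (Set.range g)).height := by
    rw [← hheight, Ideal.height_eq_inf_minimalPrimes, Ideal.height_eq_inf_minimalPrimes, hmin]
  by_contra hf
  have hzero : monomial u (1 : K) ∈ {x : MvPolynomial (Fin s) K |
      ∃ y : MvPolynomial (Fin s) K ⧸ Ideal.span (Set.range g), y ≠ 0 ∧ x • y = 0} :=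
    ⟨Ideal.Quotient.mk _ f, by rwa [Ne, Ideal.Quotient.eq_zero_iff_mem],
      Ideal.Quotient.eq_zero_iff_mem.2 h⟩
  rw [← biUnion_associatedPrimes_eq_zero_divisors] at hzero
  obtain ⟨q, hq, hu⟩ := Set.mem_iUnion₂.1 hzero
  have hqmin := mem_minimalPrimes_of_mem_associatedPrimes g hJ hq
  rw [hmin] at hqmin
  obtain ⟨y, hy, hy'⟩ := Ideal.exists_mul_mem_of_mem_minimalPrimes hqmin hu
  exact hy (mem_latticeIdeal_of_monomial_mul_mem hy')

end

end LatticeIdeals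

theorem theorem2 {K : Type*} [Field K] [CharZero K] {s : ℕ}
    (L : Ideal (MvPolynomial (Fin s) K)) (hL : LatticeIdeals.IsLatticeIdeal L) :
    (∀ (r : ℕ) (g : Fin r → MvPolynomial (Fin s) K), L.height = r →
      (∀ i, LatticeIdeals.IsBinomial (g i)) →
      L.radical = (Ideal.span (Set.range g)).radical →
      L = Ideal.span (Set.range g)) ∧
    (LatticeIdeals.IsBinomialSetTheoreticCompleteIntersection L →
      LatticeIdeals.IsCompleteIntersection L) := by
  obtain ⟨𝓛, rfl⟩ := hL
  have key (r : ℕ) (g : Fin r → MvPolynomial (Fin s) K)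
      (hheight : (LatticeIdeals.latticeIdeal K 𝓛).height = r)
      (hg : ∀ i, LatticeIdeals.IsBinomial (g i))
      (hrad : (LatticeIdeals.latticeIdeal K 𝓛).radical = (Ideal.span (Set.range g)).radical) :
      LatticeIdeals.latticeIdeal K 𝓛 = Ideal.span (Set.range g) := by
    have hJ := LatticeIdeals.eq_latticeIdeal_binomialLattice hg
      (LatticeIdeals.mem_span_of_monomial_mul_mem hheight hrad)
    have hJrad : (Ideal.span (Set.range g)).IsRadical := by
      rw [hJ]
      exact LatticeIdeals.isRadical_latticeIdeal _
    rw [← (LatticeIdeals.isRadical_latticeIdeal 𝓛).radical, hrad, hJrad.radical]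
  exact ⟨key, fun ⟨r, g, hheight, hg, hrad⟩ => ⟨r, g, hheight, key r g hheight hg hrad⟩⟩
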